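/- **Conventions.** All spaces are metric spaces and all maps are continuous. For a metric space $Z$ and $n\ge 1$, let $\mathcal B_n(Z)$ be the space of Borel probability measures on $Z$ supported by at most $n$ points, with the Lévy–Prokhorov metric. For a map $p:E\to B$ let $$E_n(p)=\bigcup_{x\in B}\mathcal B_n(p^{-1}(x))=\{\mu\in\mathcal B_n(E) : \operatorname{supp}\mu\subset p^{-1}(x)\text{ for some }x\in B\}$$ (as a subspace of $\mathcal B_n(E)$), and let $\mathcal B_n(p):E_n(p)\to B$ send $\mu$ to $x$ whenever $\operatorname{supp}\mu\subset p^{-1}(x)$. For a Hurewicz fibration $p$, the *distributional sectional category* $\mathrm{dsecat}(p)\in\{0,1,2,\dots\}\cup\{\infty\}$ is the least $n$ such that $\mathcal B_{n+1}(p):E_{n+1}(p)\to B$ admits a continuous section ($\infty$ if there is no such $n$). A *fibrational substitute* of a map $h:A\to B$ is a Hurewicz fibration $p_h:E\to B$ together with a homotopy equivalence $e:A\to E$ such that $p_h\circ e=h$. **Proposition 5.3.** 1. ($\mathrm{dsecat}$ is a homotopy invariant.) Let $p:E\to B$ and $q:Z\to C$ be Hurewicz fibrations and let $f:E\to Z$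 and $g:B\to C$ be homotopy equivalences such that $q\circ f$ is homotopic to $g\circ p$ (for instance $q\circ f=g\circ p$). Then $\mathrm{dsecat}(p)=\mathrm{dsecat}(q)$. 2. Consequently $\mathrm{dsecat}$ is well defined for arbitrary maps: every map $h:A\to B$ has a fibrational substitute, and there is exactly one value $d\in\{0,1,2,\dots\}\cup\{\infty\}$ such that $\mathrm{dsecat}(p_h)=d$ for every fibrational substitute $p_h$ of $h$; one puts $\mathrm{dsecat}(h):=d$. -/

import Mathlib

open MeasureTheory ContinuousMap
open scoped unitInterval

universe u

/-- A continuous map `p : E → B` is a Hurewicz fibration if it has the homotopy lifting property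
with respect to every topological space `Y`. -/
def IsHurewiczFibration {E B : Type u} [TopologicalSpace E] [TopologicalSpace B]
    (p : C(E, B)) : Prop :=
  ∀ (Y : Type u) [TopologicalSpace Y] (H : C(Y × I, B)) (f : C(Y, E)),
    (∀ y, H (y, 0) = p (f y)) →
      ∃ G : C(Y × I, E), (∀ y, G (y, 0) = f y) ∧ ∀ z, p (G z) = H z

/-- The space `𝓑ₙ(Z)` of Borel probability measures on the metric space `Z` that are supported by
at most `n` points. It is topologized as a subspace of the space of all Borel probability measures
with the Lévy–Prokhorov metric. -/
def DistMeasures (n : ℕ) (Z : Type u) [MetricSpace Z] [MeasurableSpace Z] [BorelSpace Z] :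
    Set (LevyProkhorov (ProbabilityMeasure Z)) :=
  {μ | ∃ F : Finset Z, F.card ≤ n ∧ (μ.toMeasure : Measure Z) (F : Set Z)ᶜ = 0}

section FibrewiseMeasures

variable {E B : Type u} [MetricSpace E] [MeasurableSpace E] [BorelSpace E] [MetricSpace B]

/-- The space `Eₙ(p) = ⋃ₓ 𝓑ₙ(p⁻¹(x))` of probability measures on `E` that are supported by at most
`n` points, all in one fibre of `p`, with the Lévy–Prokhorov metric. -/
def FibreMeasures (n : ℕ) (p : C(E, B)) : Set (LevyProkhorov (ProbabilityMeasure E)) :=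
  {μ | μ ∈ DistMeasures n E ∧ ∃ x : B, (μ.toMeasure : Measure E) (p ⁻¹' {x})ᶜ = 0}

/-- The map `𝓑ₙ(p) : Eₙ(p) → B`, sending a measure to the point of `B` over whose fibre it is
supported. -/
noncomputable def fibreProj (n : ℕ) (p : C(E, B)) (μ : FibreMeasures n p) : B :=
  μ.2.2.choose

/-- The defining property of `𝓑ₙ(p)`; in particular the point `𝓑ₙ(p)(μ)` is unique. -/
theorem fibreProj_eq_iff (n : ℕ) (p : C(E, B)) (μ : FibreMeasures n p) (x : B) :
    fibreProj n p μ = x ↔ (μ.1.toMeasure : Measure E) (p ⁻¹' {x})ᶜ = 0 := by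
  have hspec : (μ.1.toMeasure : Measure E) (p ⁻¹' {fibreProj n p μ})ᶜ = 0 := μ.2.2.choose_spec
  refine ⟨fun h => h ▸ hspec, fun hx => ?_⟩
  by_contra hne
  have huniv : (p ⁻¹' {fibreProj n p μ})ᶜ ∪ (p ⁻¹' {x})ᶜ = Set.univ := by
    ext e
    simp only [Set.mem_union, Set.mem_compl_iff, Set.mem_preimage, Set.mem_singleton_iff,
      Set.mem_univ, iff_true]
    by_contra! hcon
    exact hne (hcon.1.symm.trans hcon.2)
  have hzero := measure_union_null hspec hx
  rw [huniv, measure_univ] at hzero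
  exact one_ne_zero hzero

/-- The map `𝓑ₙ(p) : Eₙ(p) → B` admits a (continuous, strict) section. -/
def AdmitsSection (n : ℕ) (p : C(E, B)) : Prop :=
  ∃ s : C(B, FibreMeasures n p), ∀ b, fibreProj n p (s b) = b

/-- The distributional sectional category `dsecat(p)` of a fibration `p : E → B`: the least `n`
such that `𝓑ₙ₊₁(p) : Eₙ₊₁(p) → B` admits a section, and `∞` if there is no such `n`. -/
noncomputable def dsecat (p : C(E, B)) : ℕ∞ :=
  ⨅ (n : ℕ) (_ : AdmitsSection (n + 1) p), (n : ℕ∞)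

end FibrewiseMeasures

/-- `p : E → B` is a fibrational substitute of `h : A → B`: it is a Hurewicz fibration and
`h = p ∘ e` for some homotopy equivalence `e : A → E`. -/
def IsFibrationalSubstitute {A E B : Type u} [TopologicalSpace A] [TopologicalSpace E]
    [TopologicalSpace B] (p : C(E, B)) (h : C(A, B)) : Prop :=
  IsHurewiczFibration p ∧ ∃ e : A ≃ₕ E, p.comp e.toFun = h

/-!
The core is that a section `s` of `𝓑ₙ(p)` can be carried over to `𝓑ₙ(q)` along maps `f : E → Z` and
`g : B → C` with `q f ≃ g p`, as soon as `q` is a fibration and `g` has a right homotopy inverse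
`g'`. On the pullback `W` of `p` along `g'`, which consists of the pairs `(e, c)` with `p e = g' c`,
the map `(e, c) ↦ q (f e)` is homotopic to `(e, c) ↦ g (p e) = g (g' c)` and hence to
`(e, c) ↦ c`. Lifting this homotopy through `q`, starting at `f e`, ends in a map `T : W → Z` over
`C`. The measure `s (g' c)` lives on the slice of `W` at `c`, and its image under `T (·, c)` is
supported by at most `n` points of the fibre of `q` over `c` (`AdmitsSection.of_homotopic`).

The analytic input is the continuity of this family in the Lévy–Prokhorov metric, without any
separability of the spaces. Near a finitely supported measure, Lévy–Prokhorov convergence amounts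
to lower bounds on open sets (`tendsto_levyProkhorov_iff_of_finset`), a condition that passes to
images under continuous maps, even when the map varies with the parameter
(`continuous_levyProkhorov_map`).

Applying the core in both directions gives the homotopy invariance. Any two fibrational substitutes
of `h` are related by a homotopy equivalence that commutes with the projections up to homotopy, and
one substitute whose total space is a metric space is the mapping path space of `h`.
-/

/-! ### The Lévy–Prokhorov metric at finitely supported measures -/

open Topology Filter Metric in
/-- Convergence to a finitely supported measure in the Lévy–Prokhorov metric is the portmanteau
condition on open sets. No separability is needed, because only the finitely many subsets of the
support of the limit have to be tested. -/
theorem tendsto_levyProkhorov_iff_of_finset {X ι : Type*} [MetricSpace X] [MeasurableSpace X]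
    [BorelSpace X] {l : Filter ι} {ν : ι → LevyProkhorov (ProbabilityMeasure X)}
    {μ : LevyProkhorov (ProbabilityMeasure X)} {F : Finset X}
    (hF : (μ.toMeasure : Measure X) (F : Set X)ᶜ = 0) :
    Tendsto ν l (𝓝 μ) ↔ ∀ U : Set X, IsOpen U → ∀ δ : ℝ, 0 < δ → ∀ᶠ i in l,
      (μ.toMeasure : Measure X) U ≤ ((ν i).toMeasure : Measure X) U + ENNReal.ofReal δ := by
  have hsupp (A : Set X) : (μ.toMeasure : Measure X) A ≤
      (μ.toMeasure : Measure X) (A ∩ (F : Set X)) := by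
    calc (μ.toMeasure : Measure X) A
        ≤ (μ.toMeasure : Measure X) (A ∩ (F : Set X) ∪ (F : Set X)ᶜ) :=
          measure_mono fun x hx => by
            by_cases h : x ∈ (F : Set X)
            · exact Or.inl ⟨hx, h⟩
            · exact Or.inr h
      _ ≤ _ := (measure_union_le _ _).trans (by rw [hF, add_zero])
  constructor
  · intro h U hU δ hδ
    obtain ⟨ε, hε, hεU⟩ := (F.finite_toSet.inter_of_right U).isCompact.exists_thickening_subset_open
      hU Set.inter_subset_left
    have hpos : 0 < ENNReal.ofReal (min ε δ) := ENNReal.ofReal_pos.2 (lt_min hε hδ)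
    filter_upwards [EMetric.tendsto_nhds.1 h _ hpos] with i hi
    rw [edist_comm, LevyProkhorov.edist_probabilityMeasure_def] at hi
    refine (hsupp U).trans ((left_measure_le_of_levyProkhorovEDist_lt hi
      (F.finite_toSet.inter_of_right U).measurableSet).trans ?_)
    rw [ENNReal.toReal_ofReal (lt_min hε hδ).le]
    exact add_le_add
      (measure_mono ((thickening_mono (min_le_left _ _) _).trans hεU))
      (ENNReal.ofReal_le_ofReal (min_le_right _ _))
  · intro h
    refine Metric.tendsto_nhds.2 fun ε hε => ?_
    have hall : ∀ᶠ i in l, ∀ S ∈ F.powerset,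
        (μ.toMeasure : Measure X) (thickening (ε / 2) (S : Set X)) ≤
          ((ν i).toMeasure : Measure X) (thickening (ε / 2) (S : Set X))
            + ENNReal.ofReal (ε / 2) :=
      (Finset.eventually_all _).2 fun S _ => h _ isOpen_thickening _ (half_pos hε)
    filter_upwards [hall] with i hi
    rw [dist_comm, LevyProkhorov.dist_probabilityMeasure_def]
    refine (levyProkhorovDist_le_of_forall_le _ _ (half_pos hε).le fun δ A hδ _ => ?_).trans_lt
      (half_lt_self hε)
    classical
    have hS := hi (F.filter (· ∈ A)) (Finset.mem_powerset.2 (Finset.filter_subset _ _))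
    have hsub : ((F.filter (· ∈ A) : Finset X) : Set X) ⊆ A := fun x hx =>
      (Finset.mem_filter.1 hx).2
    calc (μ.toMeasure : Measure X) A ≤ (μ.toMeasure : Measure X) (A ∩ (F : Set X)) := hsupp A
      _ ≤ (μ.toMeasure : Measure X)
            (thickening (ε / 2) ((F.filter (· ∈ A) : Finset X) : Set X)) :=
          measure_mono fun x hx => self_subset_thickening (half_pos hε) _
            (Finset.mem_filter.2 ⟨hx.2, hx.1⟩)
      _ ≤ _ := hS
      _ ≤ _ := add_le_add
          (measure_mono ((thickening_mono hδ.le _).trans (thickening_subset_of_subset _ hsub)))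
          (ENNReal.ofReal_le_ofReal hδ.le)

open Topology Filter in
/-- A continuous family of finitely supported measures stays continuous when it is pushed forward
along a family of maps that is jointly continuous where the measures live. -/
theorem continuous_levyProkhorov_map {X Y D : Type*} [MetricSpace X] [MeasurableSpace X]
    [BorelSpace X] [MetricSpace Y] [MeasurableSpace Y] [BorelSpace Y] [TopologicalSpace D]
    {s : D → LevyProkhorov (ProbabilityMeasure X)} (hs : Continuous s)
    (hfin : ∀ d, ∃ F : Finset X, ((s d).toMeasure : Measure X) (F : Set X)ᶜ = 0)
    {W : Set (X × D)} (hW : ∀ d, ((s d).toMeasure : Measure X) {x | (x, d) ∈ W}ᶜ = 0)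
    {T : X × D → Y} (hT : ContinuousOn T W) (hm : ∀ d, Measurable fun x => T (x, d)) :
    Continuous fun d => LevyProkhorov.ofMeasure
      ((s d).toMeasure.map (hm d).aemeasurable) := by
  classical
  refine continuous_iff_continuousAt.2 fun d₀ => ?_
  obtain ⟨F, hF⟩ := hfin d₀
  have hF' : (((s d₀).toMeasure.map (hm d₀).aemeasurable : ProbabilityMeasure Y) : Measure Y)
      ((F.image fun x => T (x, d₀) : Finset Y) : Set Y)ᶜ = 0 := by
    rw [ProbabilityMeasure.map_apply' _ _ (Finset.measurableSet _).compl]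
    exact measure_mono_null (t := (F : Set X)ᶜ)
      (fun x hx hxF => hx (Finset.mem_image_of_mem _ hxF)) hF
  refine (tendsto_levyProkhorov_iff_of_finset hF').2 fun V hV δ hδ => ?_
  have hnhd : ∀ x : X, ∃ U : Set X, ∃ N ∈ 𝓝 d₀, IsOpen U ∧
      ((x, d₀) ∈ W → T (x, d₀) ∈ V → x ∈ U) ∧
      ∀ x' ∈ U, ∀ d ∈ N, (x', d) ∈ W → T (x', d) ∈ V := by
    intro x
    by_cases hx : (x, d₀) ∈ W ∧ T (x, d₀) ∈ V
    · have h1 := (hT _ hx.1).preimage_mem_nhdsWithin (hV.mem_nhds hx.2)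
      obtain ⟨O, hO, hOW⟩ := mem_nhdsWithin_iff_exists_mem_nhds_inter.1 h1
      obtain ⟨U, N, hU, hxU, hN, hdN, hUN⟩ := mem_nhds_prod_iff'.1 hO
      exact ⟨U, N, hN.mem_nhds hdN, hU, fun _ _ => hxU,
        fun x' hx' d hd hw => hOW ⟨hUN ⟨hx', hd⟩, hw⟩⟩
    · exact ⟨∅, Set.univ, univ_mem, isOpen_empty, fun h1 h2 => (hx ⟨h1, h2⟩).elim,
        fun x' hx' => hx'.elim⟩
  choose U N hN hU hxU hUN using hnhd
  have hev := (tendsto_levyProkhorov_iff_of_finset hF).1 hs.continuousAt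
    (⋃ x ∈ F, U x) (isOpen_biUnion fun x _ => hU x) δ hδ
  have hNF : ⋂ x ∈ F, N x ∈ 𝓝 d₀ := (biInter_finset_mem F).2 fun x _ => hN x
  filter_upwards [hev, hNF] with d hd hdN
  have hmap (d : D) := ProbabilityMeasure.map_apply' (s d).toMeasure (hm d).aemeasurable
    hV.measurableSet
  refine (hmap d₀).trans_le (le_trans ?_ (hd.trans (add_le_add (le_trans ?_ (hmap d).ge) le_rfl)))
  · refine measure_mono_ae ?_
    filter_upwards [mem_ae_iff.2 hF, mem_ae_iff.2 (hW d₀)] with x hxF hxW hxV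
    exact Set.mem_biUnion (s := (F : Set X)) hxF (hxU x hxW hxV)
  · refine measure_mono_ae ?_
    filter_upwards [mem_ae_iff.2 (hW d)] with x hxW hx
    obtain ⟨y, hy, hxy⟩ := Set.mem_iUnion₂.1 hx
    exact hUN y x hxy d (Set.mem_iInter₂.1 hdN y hy) hxW

/-! ### Transporting sections -/

/-- A section of `𝓑ₙ(p)` yields one of `𝓑ₙ(q)`. The fibre of `p` over `g' c` is moved into the fibre
of `q` over `c` by lifting a homotopy `q f e ≃ g p e = g g' c ≃ c` that is defined on the pullback
of `p` along `g'`. -/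
theorem AdmitsSection.of_homotopic {E B Z C : Type u}
    [MetricSpace E] [MeasurableSpace E] [BorelSpace E] [MetricSpace B]
    [MetricSpace Z] [MeasurableSpace Z] [BorelSpace Z] [MetricSpace C]
    {n : ℕ} {p : C(E, B)} {q : C(Z, C)} (hp : AdmitsSection n p) (hq : IsHurewiczFibration q)
    (f : C(E, Z)) (g : C(B, C)) (g' : C(C, B))
    (hgg' : (g.comp g').Homotopic (ContinuousMap.id C)) (hfg : (q.comp f).Homotopic (g.comp p)) :
    AdmitsSection n q := by
  classical
  obtain ⟨s, hs⟩ := hp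
  let W : Set (E × C) := {w | p w.1 = g' w.2}
  let prE : C(W, E) := ⟨fun w => w.1.1, by fun_prop⟩
  let prC : C(W, C) := ⟨fun w => w.1.2, by fun_prop⟩
  have hsq : (g.comp p).comp prE = (g.comp g').comp prC := by
    ext w
    exact congrArg g w.2
  have hhom : ((q.comp f).comp prE).Homotopic prC := by
    have h1 := hfg.comp (Homotopic.refl prE)
    have h2 := hgg'.comp (Homotopic.refl prC)
    rw [hsq] at h1
    exact h1.trans h2
  obtain ⟨K⟩ := hhom
  obtain ⟨G, hG0, hG⟩ := hq W (K.toContinuousMap.comp ⟨Prod.swap, continuous_swap⟩)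
    (f.comp prE) fun w => K.apply_zero w
  have hG1 (w : W) : q (G (w, 1)) = w.1.2 := (hG (w, 1)).trans (K.apply_one w)
  -- Off `W` the values do not matter, since the measures in play do not charge that part.
  let T : E × C → Z := fun w => if h : w ∈ W then G (⟨w, h⟩, 1) else f w.1
  have hTW (w : E × C) (h : w ∈ W) : T w = G (⟨w, h⟩, 1) := dif_pos h
  have hTc : ContinuousOn T W := by
    rw [continuousOn_iff_continuous_domRestrict]
    have : W.domRestrict T = fun w => G (w, 1) := funext fun w => hTW w.1 w.2
    rw [this]
    fun_prop
  have hTm (c : C) : Measurable fun e => T (e, c) := by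
    have hmeas : MeasurableSet {e : E | (e, c) ∈ W} :=
      (isClosed_eq p.continuous (continuous_const (y := g' c))).measurableSet
    refine Measurable.dite (s := {e : E | (e, c) ∈ W})
      (f := fun e => G (⟨(e.1, c), e.2⟩, 1)) (g := fun e => f e.1) ?_ ?_ hmeas
    · exact Continuous.measurable (by fun_prop)
    · exact Continuous.measurable (by fun_prop)
  have hsW (c : C) : ((s (g' c)).1.toMeasure : Measure E) {e | (e, c) ∈ W}ᶜ = 0 :=
    (fibreProj_eq_iff n p _ _).1 (hs (g' c))
  let τ : C → LevyProkhorov (ProbabilityMeasure Z) := fun c =>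
    LevyProkhorov.ofMeasure ((s (g' c)).1.toMeasure.map (hTm c).aemeasurable)
  have hτ : Continuous τ :=
    continuous_levyProkhorov_map (s := fun c => (s (g' c)).1) (by fun_prop)
      (fun c => (s (g' c)).2.1.imp fun F hF => hF.2) hsW hTc hTm
  have hτfib (c : C) : ((τ c).toMeasure : Measure Z) (q ⁻¹' {c})ᶜ = 0 := by
    rw [ProbabilityMeasure.map_apply' _ _
      (isClosed_singleton.preimage q.continuous).measurableSet.compl]
    refine measure_mono_null (t := {e : E | (e, c) ∈ W}ᶜ) (fun e he heW => he ?_) (hsW c)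
    change q (T (e, c)) = c
    rw [hTW _ heW, hG1]
  have hτfin (c : C) : τ c ∈ DistMeasures n Z := by
    obtain ⟨F, hFn, hF⟩ := (s (g' c)).2.1
    refine ⟨F.image fun e => T (e, c), Finset.card_image_le.trans hFn, ?_⟩
    rw [ProbabilityMeasure.map_apply' _ _ (Finset.measurableSet _).compl]
    exact measure_mono_null (t := (F : Set E)ᶜ)
      (fun e he heF => he (Finset.mem_image_of_mem _ heF)) hF
  exact ⟨⟨fun c => ⟨τ c, hτfin c, c, hτfib c⟩, hτ.subtype_mk _⟩,
    fun c => (fibreProj_eq_iff n q _ c).2 (hτfib c)⟩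

theorem dsecat_eq_of_homotopyEquiv {E B Z C : Type u}
    [MetricSpace E] [MeasurableSpace E] [BorelSpace E] [MetricSpace B]
    [MetricSpace Z] [MeasurableSpace Z] [BorelSpace Z] [MetricSpace C]
    {p : C(E, B)} {q : C(Z, C)} (f : E ≃ₕ Z) (g : B ≃ₕ C)
    (hp : IsHurewiczFibration p) (hq : IsHurewiczFibration q)
    (hfg : (q.comp f.toFun).Homotopic (g.toFun.comp p)) : dsecat p = dsecat q := by
  have hfg' : (p.comp f.invFun).Homotopic (g.invFun.comp q) := by
    have h1 : (p.comp f.invFun).Homotopic ((g.invFun.comp g.toFun).comp (p.comp f.invFun)) :=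
      (g.left_inv.symm.comp (Homotopic.refl (p.comp f.invFun)))
    have h2 : (g.invFun.comp ((g.toFun.comp p).comp f.invFun)).Homotopic
        (g.invFun.comp ((q.comp f.toFun).comp f.invFun)) :=
      (Homotopic.refl _).comp (hfg.symm.comp (Homotopic.refl _))
    have h3 : ((g.invFun.comp q).comp (f.toFun.comp f.invFun)).Homotopic (g.invFun.comp q) :=
      (Homotopic.refl (g.invFun.comp q)).comp f.right_inv
    exact (h1.trans h2).trans h3
  have hiff (n : ℕ) : AdmitsSection n p ↔ AdmitsSection n q :=
    ⟨fun h => h.of_homotopic hq f.toFun g.toFun g.invFun g.right_inv hfg,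
      fun h => h.of_homotopic hp f.invFun g.invFun g.toFun g.left_inv hfg'⟩
  simp only [dsecat, hiff]

theorem IsFibrationalSubstitute.dsecat_eq {A B E E' : Type u} [MetricSpace A] [MetricSpace B]
    [MetricSpace E] [MeasurableSpace E] [BorelSpace E]
    [MetricSpace E'] [MeasurableSpace E'] [BorelSpace E']
    {h : C(A, B)} {p : C(E, B)} {p' : C(E', B)}
    (hp : IsFibrationalSubstitute p h) (hp' : IsFibrationalSubstitute p' h) :
    dsecat p = dsecat p' := by
  obtain ⟨hf, e, he⟩ := hp
  obtain ⟨hf', e', he'⟩ := hp'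
  refine dsecat_eq_of_homotopyEquiv (e.symm.trans e') (ContinuousMap.HomotopyEquiv.refl B) hf hf' ?_
  have h1 : p'.comp (e.symm.trans e').toFun = p.comp (e.toFun.comp e.invFun) := by
    change (p'.comp e'.toFun).comp e.invFun = (p.comp e.toFun).comp e.invFun
    rw [he, he']
  rw [h1]
  exact (Homotopic.refl p).comp e.right_inv

/-! ### The mapping path space -/

/-- The mapping path space of `h : A → B`: points `a` of `A` with a path in `B` that starts at
`h a`. The path component carries the supremum metric. -/
def MappingPathSpace {A B : Type u} [MetricSpace A] [MetricSpace B] (h : C(A, B)) : Type u :=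
  {w : A × C(I, B) // w.2 0 = h w.1}

namespace MappingPathSpace

variable {A B : Type u} [MetricSpace A] [MetricSpace B] {h : C(A, B)}

noncomputable instance : MetricSpace (MappingPathSpace h) :=
  inferInstanceAs (MetricSpace {w : A × C(I, B) // w.2 0 = h w.1})

/-- The base point in `A` of an element of the mapping path space. -/
noncomputable def base : C(MappingPathSpace h, A) := ⟨fun w => w.1.1, continuous_subtype_val.fst⟩

/-- The path component of an element of the mapping path space. -/
noncomputable def path : C(MappingPathSpace h, C(I, B)) :=
  ⟨fun w => w.1.2, continuous_subtype_val.snd⟩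

theorem path_zero (w : MappingPathSpace h) : path w 0 = h (base w) := w.2

theorem ext {w w' : MappingPathSpace h} (h₁ : base w = base w') (h₂ : ∀ s, path w s = path w' s) :
    w = w' :=
  Subtype.ext (Prod.ext h₁ (ContinuousMap.ext h₂))

/-- A map into the mapping path space, given by its base points and by its paths in uncurried
form. -/
noncomputable def lift {Y : Type*} [TopologicalSpace Y] (a : C(Y, A)) (L : C(Y × I, B))
    (hL : ∀ y, L (y, 0) = h (a y)) : C(Y, MappingPathSpace h) :=
  ⟨fun y => ⟨(a y, L.curry y), hL y⟩, (a.continuous.prodMk L.curry.continuous).subtype_mk _⟩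

variable (h) in
/-- Evaluation at the end point of the path. -/
noncomputable def endpoint : C(MappingPathSpace h, B) :=
  ⟨fun w => path w 1, (continuous_eval_const (1 : I)).comp path.continuous⟩

/-- The lift of a homotopy `H` appends to each path the track of `H` up to time `t`. -/
theorem isHurewiczFibration_endpoint : IsHurewiczFibration (endpoint h) := by
  intro Y _ H φ hφ
  -- The concatenated path has length `1 + t` and is traversed at constant speed.
  let r : (Y × I) × I → ℝ := fun x => x.2 * (1 + x.1.2)
  have hr : Continuous r := by fun_prop
  let L : C((Y × I) × I, B) :=
    { toFun := fun x => if r x ≤ 1 then path (φ x.1.1) (Set.projIcc 0 1 zero_le_one (r x))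
        else H (x.1.1, Set.projIcc 0 1 zero_le_one (r x - 1))
      continuous_toFun := by
        refine Continuous.if_le ?_ ?_ hr continuous_const fun x hx => ?_
        · have h1 : Continuous fun x : (Y × I) × I => path (φ x.1.1) := by fun_prop
          exact h1.eval (continuous_projIcc.comp hr)
        · exact H.continuous.comp (continuous_fst.fst.prodMk
            (continuous_projIcc.comp (hr.sub continuous_const)))
        · rw [hx, sub_self, Set.projIcc_right, Set.projIcc_left]
          exact (hφ _).symm }
  have hL (x) : L x = if r x ≤ 1 then path (φ x.1.1) (Set.projIcc 0 1 zero_le_one (r x))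
      else H (x.1.1, Set.projIcc 0 1 zero_le_one (r x - 1)) := rfl
  have hL0 (z : Y × I) : L (z, 0) = h ((base.comp (φ.comp ContinuousMap.fst)) z) := by
    have hr0 : r (z, 0) = 0 := by simp [r]
    rw [hL, hr0, if_pos zero_le_one, Set.projIcc_left]
    exact path_zero _
  refine ⟨lift (base.comp (φ.comp ContinuousMap.fst)) L hL0, fun y => ?_, fun z => ?_⟩
  · refine ext rfl fun s => ?_
    have hr0 : r ((y, 0), s) = s := by simp [r]
    change L ((y, 0), s) = _
    rw [hL, hr0, if_pos s.2.2, Set.projIcc_val]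
  · obtain ⟨y, t⟩ := z
    change L ((y, t), 1) = _
    have hr1 : r ((y, t), 1) = 1 + t := by simp [r]
    rw [hL, hr1]
    split_ifs with ht
    · obtain rfl : t = 0 := le_antisymm (Subtype.coe_le_coe.1 (by simpa using ht)) t.2.1
      rw [Set.Icc.coe_zero, add_zero, Set.projIcc_right]
      exact (hφ y).symm
    · rw [add_sub_cancel_left, Set.projIcc_val]

variable (h) in
/-- The constant paths embed `A` into the mapping path space as a deformation retract, by
shrinking every path to its starting point. -/
noncomputable def homotopyEquiv : A ≃ₕ MappingPathSpace h where
  toFun := lift (ContinuousMap.id A) (h.comp ContinuousMap.fst) fun _ => rfl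
  invFun := base
  left_inv := Homotopic.refl _
  right_inv := ⟨{
    toContinuousMap := lift (base.comp ContinuousMap.snd)
      ⟨fun x : (I × MappingPathSpace h) × I => path x.1.2 (x.1.1 * x.2), by
        have h1 : Continuous fun x : (I × MappingPathSpace h) × I => path x.1.2 := by fun_prop
        exact h1.eval (continuous_fst.fst.mul continuous_snd)⟩
      fun x => by simpa using path_zero x.2
    map_zero_left := fun w => ext rfl fun s => by
      change path w (0 * s) = h (base w)
      rw [zero_mul, path_zero]
    map_one_left := fun w => ext rfl fun s => by
      change path w (1 * s) = path w s
      rw [one_mul] }⟩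

theorem isFibrationalSubstitute_endpoint : IsFibrationalSubstitute (endpoint h) h :=
  ⟨isHurewiczFibration_endpoint, homotopyEquiv h, rfl⟩

end MappingPathSpace

theorem proposition5p3 :
    -- Homotopy invariance for fibrations.
    (∀ (E B Z C : Type u)
        [MetricSpace E] [MeasurableSpace E] [BorelSpace E] [MetricSpace B]
        [MetricSpace Z] [MeasurableSpace Z] [BorelSpace Z] [MetricSpace C]
        (p : C(E, B)) (q : C(Z, C)) (f : E ≃ₕ Z) (g : B ≃ₕ C),
        IsHurewiczFibration p → IsHurewiczFibration q →
        (q.comp f.toFun).Homotopic (g.toFun.comp p) →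
        dsecat p = dsecat q) ∧
    -- Every map has a fibrational substitute, and all of them have the same `dsecat`.
    (∀ (A B : Type u) [MetricSpace A] [MetricSpace B] (h : C(A, B)),
        (∃ (E : Type u) (_ : MetricSpace E) (p : C(E, B)), IsFibrationalSubstitute p h) ∧
        ∃! d : ℕ∞, ∀ (E : Type u) [MetricSpace E] [MeasurableSpace E] [BorelSpace E] (p : C(E, B)),
          IsFibrationalSubstitute p h → dsecat p = d) := by
  refine ⟨fun E B Z C _ _ _ _ _ _ _ _ p q f g hp hq hfg =>
    dsecat_eq_of_homotopyEquiv f g hp hq hfg, fun A B _ _ h =>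
    ⟨⟨MappingPathSpace h, inferInstance, MappingPathSpace.endpoint h,
      MappingPathSpace.isFibrationalSubstitute_endpoint⟩, ?_⟩⟩
  let _ : MeasurableSpace (MappingPathSpace h) := borel _
  have : BorelSpace (MappingPathSpace h) := ⟨rfl⟩
  refine ⟨dsecat (MappingPathSpace.endpoint h), fun E _ _ _ p hp =>
    hp.dsecat_eq MappingPathSpace.isFibrationalSubstitute_endpoint, fun d hd => ?_⟩
  exact (hd _ _ MappingPathSpace.isFibrationalSubstitute_endpoint).symm
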